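/- Let $\mathcal G$ be a set and let $A=\{A(i,j)\}_{i,j\in\mathcal G}$ be a $0$-$1$ matrix with no identically zero rows. Let $\widetilde{\mathcal O}_A$ be the universal unital $C^*$-algebra generated by partial isometries $\{S_i : i\in\mathcal G\}$ such that for all $i,j\in\mathcal G$ (i) $S_i^*S_i$ and $S_j^*S_j$ commute; (ii) $(S_iS_i^*)(S_jS_j^*)=\delta_{i,j}S_iS_i^*$; (iii) $(S_i^*S_i)(S_jS_j^*)=A(i,j)S_jS_j^*$; (iv) $\prod_{x\in X}S_x^*S_x\prod_{y\in Y}(1-S_y^*S_y)=\sum_{j\in\mathcal G}A(X,Y,j)S_jS_j^*$ whenever $X,Y\subset\mathcal G$ are finite sets for which the function $j\mapsto A(X,Y,j):=\prod_{x\in X}A(x,j)\prod_{y\in Y}(1-A(y,j))$ is finitely supported. Let the Cuntz–Krieger algebra $\mathcal O_A$ be the (not necessarily unital) $C^*$-subalgebra of $\widetilde{\mathcal O}_A$ generated by the $S_i$. For $i\in\mathcal G$ let $\rho_i,\delta_i\in\ell^\infty(\mathcal G)$ be the $i$-th rows of $A$ and of the identity matrix, i.e. $\rho_i(j)=A(i,j)$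 and $\delta_i(j)=1$ if $i=j$ and $0$ otherwise, and let $R_A:=C^*(\{\rho_i,\delta_i:i\in\mathcal G\})\subset\ell^\infty(\mathcal G)$ be the (not necessarily unital) $C^*$-subalgebra they generate. Then $\mathcal O_A$ is canonically isomorphic to the universal (not necessarily unital) $C^*$-algebra generated by elements $\{S_i:i\in\mathcal G\}$ subject to the condition that the maps $\delta_i\mapsto S_iS_i^*$ and $\rho_i\mapsto S_i^*S_i$ extend to a $*$-homomorphism of $R_A$ into $C^*(\{S_i:i\in\mathcal G\})$. Explicitly: the generators $S_i$ of $\mathcal O_A$ satisfy this condition in $\mathcal O_A=C^*(\{S_i\})$, and whenever $\{T_i:i\in\mathcal G\}$ is a family in a $C^*$-algebra $B$ such that $\delta_i\mapsto T_iT_i^*$, $\rho_i\mapsto T_i^*T_i$ extend to a $*$-homomorphism $R_A\to C^*(\{T_i:i\in\mathcal G\})\subset B$, there is a unique $*$-homomorphism $\psi:\mathcal O_A\to B$ with $\psi(S_i)=T_i$ for all $i$; consequently, for any $C^*$-algebra $U$ with a generating family $\{s_i\}$ having this same universal property there is a unique $*$-isomorphism $\mathcal O_A\cong U$ carrying $S_i$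 to $s_i$ for all $i$. -/

import Mathlib

open scoped ENNReal

universe u v w

noncomputable section

namespace CuntzKrieger

/-- `C^*(s)`: the closed (not necessarily unital) star subalgebra generated by a subset `s` of a
C⋆-algebra. -/
def cstarGen {B : Type v} [NonUnitalCStarAlgebra B] (s : Set B) : NonUnitalStarSubalgebra ℂ B :=
  (NonUnitalStarAlgebra.adjoin ℂ s).topologicalClosure

instance cstarGen_isClosed {B : Type v} [NonUnitalCStarAlgebra B] (s : Set B) :
    IsClosed (cstarGen s : Set B) :=
  NonUnitalStarSubalgebra.isClosed_topologicalClosure _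

theorem subset_cstarGen {B : Type v} [NonUnitalCStarAlgebra B] (s : Set B) :
    s ⊆ (cstarGen s : Set B) :=
  (NonUnitalStarAlgebra.subset_adjoin ℂ s).trans
    (NonUnitalStarSubalgebra.le_topologicalClosure _)

/-- The unital version `C^*(s ∪ {1})`, inside a unital C⋆-algebra. -/
def unitalCstarGen {B : Type v} [CStarAlgebra B] (s : Set B) : StarSubalgebra ℂ B :=
  (StarAlgebra.adjoin ℂ s).topologicalClosure

instance unitalCstarGen_isClosed {B : Type v} [CStarAlgebra B] (s : Set B) :
    IsClosed (unitalCstarGen s : Set B) :=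
  StarSubalgebra.isClosed_topologicalClosure _

theorem subset_unitalCstarGen {B : Type v} [CStarAlgebra B] (s : Set B) :
    s ⊆ (unitalCstarGen s : Set B) :=
  (StarAlgebra.subset_adjoin ℂ s).trans (StarSubalgebra.le_topologicalClosure _)

variable {G : Type u}

/-! ### The commutative algebra `R_A` -/

/-- The `i`-th row of a `0`-`1` matrix, as an element of `ℓ^∞(G)`. -/
def row (M : Matrix G G (Fin 2)) (i : G) : lp (fun _ : G => ℂ) ∞ :=
  ⟨fun j => ((M i j : ℕ) : ℂ), memℓp_infty ⟨1, by
    rintro _ ⟨j, rfl⟩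
    have h : ((M i j : ℕ) : ℝ) ≤ 1 := by exact_mod_cast Nat.lt_succ_iff.mp (M i j).isLt
    simpa using h⟩⟩

/-- `ρ_i`: the `i`-th row of `A`. -/
def rho (A : Matrix G G (Fin 2)) (i : G) : lp (fun _ : G => ℂ) ∞ := row A i

open Classical in
/-- `δ_i`: the `i`-th row of the identity matrix. -/
def delta (i : G) : lp (fun _ : G => ℂ) ∞ := row (1 : Matrix G G (Fin 2)) i

/-- `R_A`: the C⋆-subalgebra of `ℓ^∞(G)` generated by the rows of `A` and of the identity. -/
def RAlg (A : Matrix G G (Fin 2)) : NonUnitalStarSubalgebra ℂ (lp (fun _ : G => ℂ) ∞) :=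
  cstarGen (Set.range (rho A) ∪ Set.range delta)

/-- `ρ_i` as an element of `R_A`. -/
def rhoR (A : Matrix G G (Fin 2)) (i : G) : RAlg A :=
  ⟨rho A i, subset_cstarGen _ (Or.inl ⟨i, rfl⟩)⟩

/-- `δ_i` as an element of `R_A`. -/
def deltaR (A : Matrix G G (Fin 2)) (i : G) : RAlg A :=
  ⟨delta i, subset_cstarGen _ (Or.inr ⟨i, rfl⟩)⟩

/-! ### The Cuntz–Krieger relations -/

/-- `A(X,Y,j) = ∏_{x ∈ X} A(x,j) ∏_{y ∈ Y} (1 - A(y,j))`. -/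
def coeff (A : Matrix G G (Fin 2)) (X Y : Finset G) (j : G) : ℂ :=
  (∏ x ∈ X, ((A x j : ℕ) : ℂ)) * ∏ y ∈ Y, (1 - ((A y j : ℕ) : ℂ))

open Classical in
/-- A family of partial isometries of a unital C⋆-algebra satisfying the relations (i)–(iv).
The products in (iv) are unambiguous because of (i). -/
structure IsCKFamily (A : Matrix G G (Fin 2)) {B : Type v} [CStarAlgebra B] (S : G → B) :
    Prop where
  partialIsometry : ∀ i, S i * star (S i) * S i = S i
  commute : ∀ i j, Commute (star (S i) * S i) (star (S j) * S j)
  orthogonal : ∀ i j,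
    (S i * star (S i)) * (S j * star (S j)) = if i = j then S i * star (S i) else 0
  transition : ∀ i j,
    (star (S i) * S i) * (S j * star (S j)) = ((A i j : ℕ) : ℂ) • (S j * star (S j))
  finiteSum : ∀ (X Y : Finset G) (h : (Function.support (coeff A X Y)).Finite),
    X.noncommProd (fun x => star (S x) * S x) (fun x _ y _ _ => commute x y) *
      Y.noncommProd (fun y => 1 - star (S y) * S y)
        (fun x _ y _ _ => ((Commute.one_left _).sub_left
          ((Commute.one_right _).sub_right (commute x y)))) =
    ∑ j ∈ h.toFinset, coeff A X Y j • (S j * star (S j))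

theorem norm_le_one_of_partialIsometry {B : Type v} [CStarAlgebra B] {s : B}
    (h : s * star s * s = s) : ‖s‖ ≤ 1 := by
  have h1 : ‖star s * s‖ * ‖star s * s‖ = ‖star s * s‖ := by
    rw [← CStarRing.norm_star_mul_self (x := star s * s)]
    congr 1
    rw [star_mul, star_star, mul_assoc, ← mul_assoc s, h]
  rw [CStarRing.norm_star_mul_self] at h1
  have h0 := norm_nonneg s
  by_contra! hlt
  have h2 : 1 < ‖s‖ * ‖s‖ := by nlinarith
  nlinarith

/-! ### The universal unital C⋆-algebra of the relations

Every unital C⋆-algebra generated by a family indexed by `G` has at most as many elements as there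
are sequences of noncommutative polynomials in the generators and their adjoints. So all such
algebras occur, up to isomorphism, on subsets of one fixed type, and the universal algebra is
generated by the diagonal family in the `ℓ^∞`-product of all of them. -/

/-- A unital C⋆-algebra, with underlying set inside the type of sequences of noncommutative
polynomials, together with a Cuntz–Krieger family for `A` in it. -/
structure CKRep (A : Matrix G G (Fin 2)) : Type u where
  carrier : Set (ℕ → FreeAlgebra ℂ (G ⊕ G))
  [cstar : CStarAlgebra carrier]
  [nontriv : Nontrivial carrier]
  gen : G → carrier
  isCKFamily : IsCKFamily A gen

attribute [instance] CKRep.cstar CKRep.nontriv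

/-- The `ℓ^∞`-product of all the representations. -/
abbrev Ambient (A : Matrix G G (Fin 2)) : Type u := lp (fun π : CKRep A => π.carrier) ∞

instance ambientCStarAlgebra (A : Matrix G G (Fin 2)) : CStarAlgebra (Ambient A) where

/-- The diagonal family. -/
def ambientGen (A : Matrix G G (Fin 2)) (i : G) : Ambient A :=
  ⟨fun π => π.gen i, memℓp_infty ⟨1, by
    rintro _ ⟨π, rfl⟩
    exact norm_le_one_of_partialIsometry (π.isCKFamily.partialIsometry i)⟩⟩

/-- The unital Cuntz–Krieger algebra `\tilde O_A`: the universal unital C⋆-algebra generated by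
partial isometries satisfying (i)–(iv). -/
def OTilde (A : Matrix G G (Fin 2)) : Type u := unitalCstarGen (Set.range (ambientGen A))

instance oTildeCStarAlgebra (A : Matrix G G (Fin 2)) : CStarAlgebra (OTilde A) :=
  StarSubalgebra.cstarAlgebra (unitalCstarGen (Set.range (ambientGen A)))

/-- The canonical generators of `\tilde O_A`. -/
def genTilde (A : Matrix G G (Fin 2)) (i : G) : OTilde A :=
  ⟨ambientGen A i, subset_unitalCstarGen _ ⟨i, rfl⟩⟩

/-! `\tilde O_A` does have the universal property that defines it. -/

theorem map_noncommProd_mul {C : Type v} [CStarAlgebra C] {B : Type w} [CStarAlgebra B]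
    (f : C →⋆ₐ[ℂ] B) (S : G → C) (X Y : Finset G) (h1 h2 h3 h4) :
    f (X.noncommProd (fun x => star (S x) * S x) h1 *
      Y.noncommProd (fun y => 1 - star (S y) * S y) h2) =
    X.noncommProd (fun x => star (f (S x)) * f (S x)) h3 *
      Y.noncommProd (fun y => 1 - star (f (S y)) * f (S y)) h4 := by
  have hs : ∀ x, f (star x) = star (f x) := map_star f
  rw [map_mul f, Finset.map_noncommProd X _ h1 f, Finset.map_noncommProd Y _ h2 f]
  congr 1
  · exact Finset.noncommProd_congr rfl (fun x _ => by rw [map_mul, hs]) _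
  · exact Finset.noncommProd_congr rfl (fun x _ => by rw [map_sub, map_mul, hs, map_one]) _

theorem isCKFamily_of_jointly_injective {A : Matrix G G (Fin 2)} {C : Type v} [CStarAlgebra C]
    {S : G → C} {I : Type w} {B : I → Type*} [∀ i, CStarAlgebra (B i)]
    (f : ∀ i, C →⋆ₐ[ℂ] B i) (hf : ∀ x y, (∀ i, f i x = f i y) → x = y)
    (h : ∀ i, IsCKFamily A (fun g => f i (S g))) : IsCKFamily A S := by
  have hs : ∀ i x, f i (star x) = star (f i x) := fun i => map_star (f i)
  have hc : ∀ i (c : ℂ) x, f i (c • x) = c • f i x := fun i => map_smul (f i)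
  refine ⟨fun g => hf _ _ fun i => ?_, fun g g' => hf _ _ fun i => ?_,
    fun g g' => hf _ _ fun i => ?_, fun g g' => hf _ _ fun i => ?_,
    fun X Y hXY => hf _ _ fun i => ?_⟩
  · simpa only [map_mul, hs] using (h i).partialIsometry g
  · have := (h i).commute g g'
    simp only [commute_iff_eq] at this
    simpa only [map_mul, hs] using this
  · have := (h i).orthogonal g g'
    split_ifs at this ⊢ <;> simpa only [map_mul, hs, map_zero] using this
  · simpa only [map_mul, hs, hc] using (h i).transition g g'
  · have := (h i).finiteSum X Y hXY
    refine (map_noncommProd_mul (f i) S X Y _ _ _ _).trans (this.trans ?_)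
    simp only [map_sum, map_mul, hs, hc]

/-- Evaluation of the product at one representation. -/
def evalRep {A : Matrix G G (Fin 2)} (π : CKRep A) : Ambient A →⋆ₐ[ℂ] π.carrier where
  toFun x := x π
  map_one' := rfl
  map_mul' _ _ := rfl
  map_zero' := rfl
  map_add' _ _ := rfl
  commutes' _ := rfl
  map_star' _ := rfl

/-- The canonical generators of `\tilde O_A` satisfy (i)–(iv). -/
theorem isCKFamily_genTilde (A : Matrix G G (Fin 2)) : IsCKFamily A (genTilde A) :=
  isCKFamily_of_jointly_injective (I := CKRep A)
    (fun π => (evalRep π).comp (unitalCstarGen (Set.range (ambientGen A))).subtype)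
    (fun _ _ h => Subtype.ext <| lp.ext <| funext fun π => h π) (fun π => π.isCKFamily)

theorem IsCKFamily.map {A : Matrix G G (Fin 2)} {C : Type v} [CStarAlgebra C]
    {S : G → C} (h : IsCKFamily A S) {B : Type w} [CStarAlgebra B] (f : C →⋆ₐ[ℂ] B) :
    IsCKFamily A (fun g => f (S g)) := by
  have hs : ∀ x, f (star x) = star (f x) := map_star f
  have hc : ∀ (c : ℂ) x, f (c • x) = c • f x := map_smul f
  have hcomm : ∀ g g', Commute (star (f (S g)) * f (S g)) (star (f (S g')) * f (S g')) :=
    fun g g' => by simpa only [map_mul, hs] using (h.commute g g').map f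
  refine ⟨fun g => ?_, hcomm, fun g g' => ?_, fun g g' => ?_, fun X Y hXY => ?_⟩
  · simpa only [map_mul, hs] using congrArg f (h.partialIsometry g)
  · have := congrArg f (h.orthogonal g g')
    split_ifs at this ⊢ <;> simpa only [map_mul, hs, map_zero] using this
  · simpa only [map_mul, hs, hc] using congrArg f (h.transition g g')
  · have := congrArg f (h.finiteSum X Y hXY)
    refine (map_noncommProd_mul f S X Y _ _ _ _).symm.trans (this.trans ?_)
    simp only [map_sum, map_mul, hs, hc]

/-- A C⋆-algebra structure can be transported along a bijection. -/
theorem exists_transport {X : Type v} {B : Type w} [CStarAlgebra B] (e : X ≃ B) :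
    ∃ (_ : CStarAlgebra X) (f : X ≃⋆ₐ[ℂ] B), ∀ x, f x = e x := by
  let r : NormedRing X := e.normedRing
  let s : StarRing X := e.starRing
  let a : Algebra ℂ X := e.algebra ℂ
  have hn : ∀ x : X, ‖x‖ = ‖e x‖ := fun x => rfl
  let na : NormedAlgebra ℂ X := NormedAlgebra.mk (toAlgebra := a) (fun c x => by
    change ‖e (e.symm (c • e x))‖ ≤ _ * ‖e x‖
    simpa using norm_smul_le c (e x))
  have hd : Isometry e := Isometry.of_dist_eq fun x y => by
    rw [dist_eq_norm, dist_eq_norm, hn]; congr 1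
    exact (e.apply_symm_apply _).symm
  have : CompleteSpace X :=
    (IsUniformInducing.completeSpace_congr hd.isUniformInducing e.surjective).mpr inferInstance
  have : CStarRing X := ⟨fun x => by
    change ‖e x‖ * ‖e x‖ ≤ ‖e (e.symm (e (e.symm (star (e x))) * e x))‖
    simp [CStarRing.norm_star_mul_self]⟩
  have : StarModule ℂ X := ⟨fun c x => by
    apply e.injective
    change e (e.symm (star (e (e.symm (c • e x))))) = e (e.symm (star c • e (e.symm (star (e x)))))
    simp⟩
  refine ⟨{
            toNormedRing := r, toStarRing := s, toCompleteSpace := ‹_›,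
            toCStarRing := ‹_›, toNormedAlgebra := na, toStarModule := ‹_› },
    ⟨⟨⟨e, fun _ _ => e.apply_symm_apply _,
    fun _ _ => e.apply_symm_apply _⟩, ?_⟩, ?_⟩, fun x => rfl⟩
  · intro x; exact e.apply_symm_apply _
  · intro c x; exact e.apply_symm_apply _

/-- A C⋆-algebra generated by a family indexed by `G` is no larger than the set of sequences of
noncommutative polynomials. -/
theorem exists_injection {B : Type w} [CStarAlgebra B] (T : G → B) :
    ∃ j : unitalCstarGen (Set.range T) → (ℕ → FreeAlgebra ℂ (G ⊕ G)), Function.Injective j := by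
  let ev : FreeAlgebra ℂ (G ⊕ G) →ₐ[ℂ] B := FreeAlgebra.lift ℂ (Sum.elim T (fun g => star (T g)))
  have hmem : ∀ b ∈ StarAlgebra.adjoin ℂ (Set.range T), ∃ p, ev p = b := by
    intro b hb
    have hb' : b ∈ Algebra.adjoin ℂ (Set.range T ∪ star (Set.range T)) := hb
    have : Algebra.adjoin ℂ (Set.range T ∪ star (Set.range T)) ≤ ev.range := by
      refine Algebra.adjoin_le ?_
      rintro x (⟨g, rfl⟩ | hx)
      · exact ⟨FreeAlgebra.ι ℂ (Sum.inl g), by simp [ev]⟩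
      · obtain ⟨g, hg⟩ := hx
        exact ⟨FreeAlgebra.ι ℂ (Sum.inr g), by simp [ev, hg]⟩
    exact this hb'
  have hseq : ∀ b : unitalCstarGen (Set.range T), ∃ p : ℕ → FreeAlgebra ℂ (G ⊕ G),
      Filter.Tendsto (fun n => ev (p n)) Filter.atTop (nhds (b : B)) := by
    rintro ⟨b, hb⟩
    obtain ⟨x, hx, hlim⟩ := mem_closure_iff_seq_limit.mp hb
    choose p hp using fun n => hmem (x n) (hx n)
    exact ⟨p, by simpa only [hp] using hlim⟩
  choose j hj using hseq
  exact ⟨j, fun a b hab => Subtype.ext (tendsto_nhds_unique (hj a) (by rw [hab]; exact hj b))⟩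

/-- The universal property of `\tilde O_A` with respect to (i)–(iv). -/
theorem oTilde_universal (A : Matrix G G (Fin 2)) {B : Type w} [CStarAlgebra B] (T : G → B)
    (hT : IsCKFamily A T) : ∃! ψ : OTilde A →⋆ₐ[ℂ] B, ∀ i, ψ (genTilde A i) = T i := by
  refine existsUnique_of_exists_of_unique ?_ ?_
  · rcases subsingleton_or_nontrivial B with hB | hB
    · exact ⟨{ toFun := fun _ => 0, map_one' := Subsingleton.elim _ _,
               map_mul' := fun _ _ => Subsingleton.elim _ _, map_zero' := rfl,
               map_add' := fun _ _ => Subsingleton.elim _ _,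
               commutes' := fun _ => Subsingleton.elim _ _,
               map_star' := fun _ => Subsingleton.elim _ _ }, fun _ => Subsingleton.elim _ _⟩
    · obtain ⟨j, hj⟩ := exists_injection T
      let C := unitalCstarGen (Set.range T)
      let ι : C →⋆ₐ[ℂ] B := C.subtype
      let T' : G → C := fun g => ⟨T g, subset_unitalCstarGen _ ⟨g, rfl⟩⟩
      have hT' : IsCKFamily A T' := isCKFamily_of_jointly_injective (I := Unit) (fun _ => ι)
        (fun _ _ h => Subtype.ext (h ())) (fun _ => hT)
      obtain ⟨inst, f, hf⟩ := exists_transport (Equiv.ofInjective j hj).symm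
      have hnt : Nontrivial C := inferInstance
      have : Nontrivial (Set.range j) := (Equiv.ofInjective j hj).symm.nontrivial
      let fs : C →⋆ₐ[ℂ] Set.range j := (f.symm : C →⋆ₐ[ℂ] Set.range j)
      let π : CKRep A := ⟨Set.range j, fun g => fs (T' g), hT'.map fs⟩
      refine ⟨(ι.comp (f : Set.range j →⋆ₐ[ℂ] C)).comp
        ((evalRep π).comp (unitalCstarGen (Set.range (ambientGen A))).subtype), fun g => ?_⟩
      change ι (f (f.symm (T' g))) = T g
      rw [f.apply_symm_apply]
      rfl
  · intro φ ψ hφ hψ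
    refine StarAlgHom.ext_topologicalClosure
      (S := StarAlgebra.adjoin ℂ (Set.range (ambientGen A)))
      (NonUnitalStarAlgHom.instContinuousLinearMapClassComplex.map_continuous φ)
      (NonUnitalStarAlgHom.instContinuousLinearMapClassComplex.map_continuous ψ) ?_
    refine StarAlgHom.ext_adjoin ?_
    rintro ⟨_, _⟩ ⟨g, rfl⟩
    exact (hφ g).trans (hψ g).symm

/-- The Cuntz–Krieger algebra `O_A`: the C⋆-subalgebra of `\tilde O_A` generated by the `S_i`. -/
def OAlg (A : Matrix G G (Fin 2)) : Type u := cstarGen (Set.range (genTilde A))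

instance oAlgNonUnitalCStarAlgebra (A : Matrix G G (Fin 2)) : NonUnitalCStarAlgebra (OAlg A) :=
  NonUnitalStarSubalgebra.nonUnitalCStarAlgebra (cstarGen (Set.range (genTilde A)))

/-- The canonical generators `S_i` of `O_A`. -/
def genO (A : Matrix G G (Fin 2)) (i : G) : OAlg A :=
  ⟨genTilde A i, subset_cstarGen _ ⟨i, rfl⟩⟩

/-! ### The condition in terms of `R_A`, and universality -/

/-- The maps `δ_i ↦ T_i T_i^*` and `ρ_i ↦ T_i^* T_i` extend to a homomorphism of `R_A` into
`C^*({T_i})`. -/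
def ExtendsToRAlg (A : Matrix G G (Fin 2)) {B : Type v} [NonUnitalCStarAlgebra B] (T : G → B) :
    Prop :=
  ∃ φ : RAlg A →⋆ₙₐ[ℂ] cstarGen (Set.range T), ∀ i,
    (φ (deltaR A i) : B) = T i * star (T i) ∧ (φ (rhoR A i) : B) = star (T i) * T i

/-- `U`, with the family `S`, is the universal (not necessarily unital) C⋆-algebra generated by
elements subject to the condition `ExtendsToRAlg A`. The universal property is tested on
C⋆-algebras in the universe `w`. -/
structure IsUniversalForRAlg (A : Matrix G G (Fin 2)) (U : Type v) [NonUnitalCStarAlgebra U]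
    (S : G → U) : Prop where
  generates : cstarGen (Set.range S) = ⊤
  condition : ExtendsToRAlg A S
  lift : ∀ (B : Type w) [NonUnitalCStarAlgebra B] (T : G → B), ExtendsToRAlg A T →
    ∃! ψ : U →⋆ₙₐ[ℂ] B, ∀ i, ψ (S i) = T i

end CuntzKrieger

end

noncomputable section

namespace CuntzKrieger

variable {G : Type u}

/-! ### Non-unital star homomorphisms and generated subalgebras -/

/-! Relations (i)–(iv) are identities between 0-1 functions on `G`, and the theorem says that they
generate all the relations among the rows `ρ_i` and `δ_i` in `ℓ^∞(G)`.

From relations to `R_A` (`IsCKFamily.exists_hom`): the projections `S_i^*S_i` and `S_iS_i^*`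
generate a commutative unital algebra `D`. A character of `D` gives a 0-1 point `(p, q)`, which is a
limit of the points `(A(·,j), δ_{·,j})`, `j ∈ G` (`IsDiagonalPoint.exists_filter`). If some `q_j =
1`, the point is the one at `j`; otherwise (iv) forces every finite pattern of `p` to occur in
infinitely many columns. Hence polynomials in the projections are dominated in norm by the same
polynomials in the rows, which gives the homomorphism.

From `R_A` to relations (`IsRowAlgebra.isCKFamily`): each relation holds coordinatewise in the
unitization of `R_A` and is carried over by the homomorphism. The coordinates fail to separate the
unitization only if `R_A` contains the constant function 1, and then its image must be the unit of
the target. `IsRowAlgebra.exists_isCKFamily_embedding` chooses the unital target accordingly.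

The universal property of `OTilde A` then yields that of `OAlg A`, and uniqueness is the usual
argument for universal objects. -/

theorem cstarGen_le {B : Type v} [NonUnitalCStarAlgebra B] {s : Set B}
    {D : NonUnitalStarSubalgebra ℂ B} (hD : IsClosed (D : Set B)) (h : s ⊆ D) : cstarGen s ≤ D :=
  NonUnitalStarSubalgebra.topologicalClosure_minimal _ (NonUnitalStarAlgebra.adjoin_le h) hD

theorem map_mem_of_cstarGen_eq_top {C : Type v} {B : Type w} [NonUnitalCStarAlgebra C]
    [NonUnitalCStarAlgebra B] {s : Set C} (hs : cstarGen s = ⊤) (f : C →⋆ₙₐ[ℂ] B)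
    {D : NonUnitalStarSubalgebra ℂ B} (hD : IsClosed (D : Set B)) (h : ∀ x ∈ s, f x ∈ D) (x : C) :
    f x ∈ D := by
  have hf : Continuous f :=
    NonUnitalStarAlgHom.instContinuousLinearMapClassComplex.map_continuous f
  have : cstarGen s ≤ D.comap f := cstarGen_le (hD.preimage hf) h
  exact this (hs ▸ trivial)

theorem hom_ext_of_cstarGen_eq_top {C : Type v} {B : Type w} [NonUnitalCStarAlgebra C]
    [NonUnitalCStarAlgebra B] {s : Set C} (hs : cstarGen s = ⊤) {f g : C →⋆ₙₐ[ℂ] B}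
    (h : ∀ x ∈ s, f x = g x) : f = g := by
  have hf : Continuous f :=
    NonUnitalStarAlgHom.instContinuousLinearMapClassComplex.map_continuous f
  have hg : Continuous g :=
    NonUnitalStarAlgHom.instContinuousLinearMapClassComplex.map_continuous g
  have : cstarGen s ≤ NonUnitalStarAlgHom.equalizer f g :=
    cstarGen_le (isClosed_eq hf hg) h
  exact DFunLike.ext _ _ fun x => this (hs ▸ trivial : x ∈ cstarGen s)

/-- Lets homomorphisms out of a generated subalgebra be controlled on its generators. The inclusion
is a closed embedding, so the image of the inner closure is closed and contains `s`. -/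
theorem cstarGen_coe_preimage {B : Type v} [NonUnitalCStarAlgebra B] (s : Set B) :
    cstarGen ((↑) ⁻¹' s : Set (cstarGen s)) = ⊤ := by
  let D := cstarGen s
  let t : Set D := (↑) ⁻¹' s
  let ι : D →⋆ₙₐ[ℂ] B := NonUnitalStarSubalgebraClass.subtype D
  have hc : Topology.IsClosedEmbedding ((↑) : D → B) :=
    (cstarGen_isClosed s).isClosedEmbedding_subtypeVal
  have hle : D ≤ (cstarGen t).map ι := by
    refine cstarGen_le ?_ fun x hx => ?_
    · rw [NonUnitalStarSubalgebra.coe_map]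
      exact hc.isClosedMap _ (cstarGen_isClosed t)
    · exact NonUnitalStarSubalgebra.mem_map.mpr
        ⟨⟨x, subset_cstarGen s hx⟩, subset_cstarGen t hx, rfl⟩
  refine eq_top_iff.mpr fun x _ => ?_
  obtain ⟨y, hy, hxy⟩ := NonUnitalStarSubalgebra.mem_map.mp (hle x.2)
  rwa [← Subtype.ext hxy]

/-- Lifting a homomorphism along an injective one; it suffices that the generators lift. -/
theorem exists_lift_of_injective {C : Type u} {D : Type v} {E : Type w} [NonUnitalCStarAlgebra C]
    [NonUnitalCStarAlgebra D] [NonUnitalCStarAlgebra E] {s : Set C} (hs : cstarGen s = ⊤)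
    (f : C →⋆ₙₐ[ℂ] E) (ι : D →⋆ₙₐ[ℂ] E) (hι : Function.Injective ι)
    (h : ∀ x ∈ s, ∃ y, ι y = f x) : ∃ g : C →⋆ₙₐ[ℂ] D, ∀ x, ι (g x) = f x := by
  -- Injective star homomorphisms of C⋆-algebras are isometric, so the range is complete; it then
  -- contains `f x` as soon as it contains the images of the generators.
  have hcl : IsClosed (NonUnitalStarAlgHom.range ι : Set E) := by
    have hi : Isometry ι := NonUnitalStarAlgHom.isometry ι hι
    rw [NonUnitalStarAlgHom.coe_range]
    exact hi.isClosedEmbedding.isClosed_range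
  have hmem : ∀ x, ∃ y, ι y = f x := fun x =>
    map_mem_of_cstarGen_eq_top hs f (D := NonUnitalStarAlgHom.range ι) hcl h x
  choose g hg using hmem
  exact ⟨{ toFun := g
           map_smul' := fun c x => hι (by simp [hg, map_smul])
           map_zero' := hι (by simp [hg])
           map_add' := fun x y => hι (by simp [hg])
           map_mul' := fun x y => hι (by simp [hg])
           map_star' := fun x => hι (by simp [hg, map_star]) }, hg⟩

/-- A non-unital C⋆-algebra with a two-sided unit element is a unital C⋆-algebra. -/
@[reducible] def cstarAlgebraOfUnit {C : Type v} (inst : NonUnitalCStarAlgebra C) (e : C)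
    (h1 : ∀ x, e * x = x) (h2 : ∀ x, x * e = x) : CStarAlgebra C :=
  let r : NormedRing C :=
    { (inferInstance : NonUnitalNormedRing C) with
      one := e
      one_mul := h1
      mul_one := h2 }
  let a : Algebra ℂ C := Algebra.ofModule smul_mul_assoc mul_smul_comm
  { r, inst with
    toAlgebra := a
    norm_smul_le := norm_smul_le }

/-- The existential over `E` keeps the new unital structure apart from the given one on the same
type. -/
theorem exists_cstarAlgebra_of_unit {C : Type v} [inst : NonUnitalCStarAlgebra C] (e : C)
    (h1 : ∀ x, e * x = x) (h2 : ∀ x, x * e = x) :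
    ∃ (E : Type v) (_ : CStarAlgebra E) (ι : C →⋆ₙₐ[ℂ] E), Function.Injective ι ∧ ι e = 1 := by
  let i2 := cstarAlgebraOfUnit inst e h1 h2
  exact ⟨C, i2, NonUnitalStarAlgHom.id ℂ C, fun _ _ h => h, rfl⟩

theorem exists_unital_embedding {C : Type v} [NonUnitalCStarAlgebra C] :
    ∃ (E : Type v) (_ : CStarAlgebra E) (ι : C →⋆ₙₐ[ℂ] E), Function.Injective ι :=
  ⟨Unitization ℂ C, inferInstance, Unitization.inrNonUnitalStarAlgHom ℂ C,
    Unitization.inr_injective⟩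

/-! ### Generators of `R_A` and of the diagonal of a Cuntz–Krieger family -/

@[simp] theorem rho_apply (A : Matrix G G (Fin 2)) (i j : G) : rho A i j = ((A i j : ℕ) : ℂ) := rfl

open Classical in
@[simp] theorem delta_apply (i j : G) :
    (delta i : lp (fun _ : G => ℂ) ∞) j = if i = j then 1 else 0 := by
  change (((1 : Matrix G G (Fin 2)) i j : ℕ) : ℂ) = _
  rw [Matrix.one_apply]
  split_ifs <;> simp

theorem entry_eq_zero_or_one (A : Matrix G G (Fin 2)) (i j : G) :
    ((A i j : ℕ) : ℂ) = 0 ∨ ((A i j : ℕ) : ℂ) = 1 := by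
  have : ∀ a : Fin 2, ((a : ℕ) : ℂ) = 0 ∨ ((a : ℕ) : ℂ) = 1 := by
    intro a; fin_cases a <;> simp
  exact this _

theorem coeff_ne_zero_iff (A : Matrix G G (Fin 2)) (X Y : Finset G) (j : G) :
    coeff A X Y j ≠ 0 ↔ (∀ x ∈ X, ((A x j : ℕ) : ℂ) = 1) ∧ ∀ y ∈ Y, ((A y j : ℕ) : ℂ) = 0 := by
  rw [coeff, mul_ne_zero_iff, Finset.prod_ne_zero_iff, Finset.prod_ne_zero_iff]
  refine and_congr (forall₂_congr fun x _ => ?_) (forall₂_congr fun y _ => ?_)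
  · rcases entry_eq_zero_or_one A x j with h | h <;> simp [h]
  · rcases entry_eq_zero_or_one A y j with h | h <;> simp [h]

section Diagonal

variable {A : Matrix G G (Fin 2)} {B : Type v} [CStarAlgebra B] {S : G → B}

/-- Values of a complex homomorphism on the diagonal of a Cuntz–Krieger family, with the relations
they inherit. -/
structure IsDiagonalPoint (A : Matrix G G (Fin 2)) (p q : G → ℂ) : Prop where
  p_eq : ∀ i, p i = 0 ∨ p i = 1
  q_eq : ∀ i, q i = 0 ∨ q i = 1
  orthogonal : ∀ i j, i ≠ j → q i * q j = 0
  transition : ∀ i j, p i * q j = ((A i j : ℕ) : ℂ) * q j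
  finiteSum : ∀ (X Y : Finset G) (h : (Function.support (coeff A X Y)).Finite),
    (∏ x ∈ X, p x) * ∏ y ∈ Y, (1 - p y) = ∑ j ∈ h.toFinset, coeff A X Y j * q j

open Filter in
/-- Every diagonal point is a limit of the points given by the columns of `A`. -/
theorem IsDiagonalPoint.exists_filter {p q : G → ℂ} (h : IsDiagonalPoint A p q) :
    ∃ L : Filter G, L.NeBot ∧ (∀ i, ∀ᶠ j in L, rho A i j = p i) ∧
      ∀ i, ∀ᶠ j in L, (delta i : lp (fun _ : G => ℂ) ∞) j = q i := by
  classical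
  by_cases hq : ∃ j, q j = 1
  -- With `q j = 1`, `transition` gives `p i = A i j` and `orthogonal` gives `q i = 0` for `i ≠ j`:
  -- the point sits at column `j`.
  · obtain ⟨j, hj⟩ := hq
    refine ⟨pure j, inferInstance, fun i => ?_, fun i => ?_⟩
    · have := h.transition i j
      simpa [hj] using this.symm
    · by_cases hij : i = j
      · simp [hij, hj]
      · have := h.orthogonal i j hij
        rw [hj, mul_one] at this
        simp [hij, this]
  · have hq0 : ∀ j, q j = 0 := fun j => (h.q_eq j).resolve_right fun hj => hq ⟨j, hj⟩
    -- The pattern sets make `rho A i` converge to `p i`; `cofinite` makes `delta i` converge to 0.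
    -- Properness is the content of (iv).
    let L : Filter G := cofinite ⊓ ⨅ i, 𝓟 {j | rho A i j = p i}
    have hb : (⨅ i, 𝓟 {j | rho A i j = p i}).HasBasis (fun F : Set G => F.Finite)
        fun F => ⋂ i ∈ F, {j | rho A i j = p i} := hasBasis_iInf_principal_finite _
    refine ⟨L, ?_, fun i => ?_, fun i => ?_⟩
    · rw [(hasBasis_cofinite.inf hb).neBot_iff]
      rintro ⟨K, F⟩ ⟨hK, hF⟩
      by_contra hemp
      rw [Set.not_nonempty_iff_eq_empty] at hemp
      lift F to Finset G using hF
      let X := F.filter fun i => p i = 1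
      let Y := F.filter fun i => p i = 0
      -- If no column outside the finite set `K` matched `p` on `F`, the coefficient for this
      -- pattern would be supported in `K`, and (iv) would read `1 = 0` because every `q j`
      -- vanishes.
      have hfin : (Function.support (coeff A X Y)).Finite := by
        refine Set.Finite.subset hK fun j hj => ?_
        by_contra hjK
        have hj' := (coeff_ne_zero_iff A X Y j).mp hj
        have : j ∈ Kᶜ ∩ ⋂ i ∈ (F : Set G), {j | rho A i j = p i} := by
          refine ⟨hjK, Set.mem_iInter₂.mpr fun i hi => ?_⟩
          rcases h.p_eq i with hi0 | hi1
          · rw [Set.mem_ofPred_eq, hi0]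
            exact hj'.2 i (Finset.mem_filter.mpr ⟨hi, hi0⟩)
          · rw [Set.mem_ofPred_eq, hi1]
            exact hj'.1 i (Finset.mem_filter.mpr ⟨hi, hi1⟩)
        exact absurd this (by rw [hemp]; exact Set.notMem_empty j)
      have hsum := h.finiteSum X Y hfin
      rw [Finset.prod_eq_one (fun x hx => (Finset.mem_filter.mp hx).2),
        Finset.prod_eq_one (fun y hy => by rw [(Finset.mem_filter.mp hy).2, sub_zero])] at hsum
      simp [hq0] at hsum
    · exact (inf_le_right.trans (iInf_le _ i) : L ≤ _) (mem_principal_self _)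
    · have : ∀ᶠ j in L, j ≠ i :=
        (inf_le_left : L ≤ cofinite) (Set.finite_singleton i).compl_mem_cofinite
      filter_upwards [this] with j hj
      simp [hq0, hj.symm]

theorem IsCKFamily.commute_domain_range (h : IsCKFamily A S) (i j : G) :
    Commute (star (S i) * S i) (S j * star (S j)) := by
  have h1 := h.transition i j
  have h2 := congrArg star h1
  simp only [star_mul, star_star, star_smul, star_natCast] at h2
  exact h1.trans h2.symm

theorem IsCKFamily.commute_range (h : IsCKFamily A S) (i j : G) :
    Commute (S i * star (S i)) (S j * star (S j)) := by
  by_cases hij : i = j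
  · rw [hij]
  · have h1 := h.orthogonal i j
    have h2 := h.orthogonal j i
    rw [if_neg hij] at h1
    rw [if_neg (Ne.symm hij)] at h2
    exact h1.trans h2.symm

/-- A complex homomorphism defined on an algebra mapping to `B` gives a diagonal point. -/
theorem IsCKFamily.isDiagonalPoint (h : IsCKFamily A S) {D : Type w} [CStarAlgebra D]
    (f : D →⋆ₐ[ℂ] B) (hf : Function.Injective f) (P Q : G → D)
    (hP : ∀ i, f (P i) = star (S i) * S i) (hQ : ∀ i, f (Q i) = S i * star (S i))
    (χ : D →ₐ[ℂ] ℂ) : IsDiagonalPoint A (fun i => χ (P i)) fun i => χ (Q i) := by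
  have idem : ∀ z : ℂ, z * z = z → z = 0 ∨ z = 1 := fun z hz => by
    rcases mul_eq_zero.mp (show z * (z - 1) = 0 by rw [mul_sub, hz, mul_one, sub_self]) with h | h
    · exact Or.inl h
    · exact Or.inr (sub_eq_zero.mp h)
  have hc : ∀ (c : ℂ) x, f (c • x) = c • f x := map_smul f
  have hcomm : ∀ i j, Commute (P i) (P j) := fun i j => hf <| by
    simp only [map_mul, hP]; exact h.commute i j
  refine ⟨fun i => idem _ ?_, fun i => idem _ ?_, fun i j hij => ?_, fun i j => ?_,
    fun X Y hXY => ?_⟩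
  · rw [← map_mul]
    congr 1
    apply hf
    rw [map_mul, hP, mul_assoc, ← mul_assoc (S i), h.partialIsometry]
  · rw [← map_mul]
    congr 1
    apply hf
    rw [map_mul, hQ, ← mul_assoc, h.partialIsometry]
  · rw [← map_mul, ← map_zero χ]
    congr 1
    apply hf
    rw [map_mul, hQ, hQ, h.orthogonal, if_neg hij, map_zero]
  · have hD : P i * Q j = ((A i j : ℕ) : ℂ) • Q j := by
      apply hf
      rw [map_mul, hP, hQ, h.transition, hc, hQ]
    simpa only [map_mul, map_smul, smul_eq_mul] using congrArg χ hD
  · have hX : (X : Set G).Pairwise (Function.onFun Commute P) := fun x _ y _ _ => hcomm x y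
    have hY : (Y : Set G).Pairwise (Function.onFun Commute fun y => 1 - P y) :=
      fun x _ y _ _ => (Commute.one_left _).sub_left ((Commute.one_right _).sub_right (hcomm x y))
    -- Relation (iv) is first pulled back to `D` along the injective `f`; only there can `χ` be
    -- applied, turning the products into ordinary ones in `ℂ`.
    have hD : X.noncommProd P hX * Y.noncommProd (fun y => 1 - P y) hY =
        ∑ j ∈ hXY.toFinset, coeff A X Y j • Q j := by
      apply hf
      rw [map_mul, Finset.map_noncommProd, Finset.map_noncommProd, map_sum]
      simp only [hP, hQ, hc, map_sub, map_one]
      exact h.finiteSum X Y hXY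
    have := congrArg χ hD
    rw [map_mul, Finset.map_noncommProd, Finset.map_noncommProd, map_sum,
      Finset.noncommProd_eq_prod, Finset.noncommProd_eq_prod] at this
    simpa only [map_sub, map_one, map_smul, smul_eq_mul] using this

end Diagonal

/-! ### A Cuntz–Krieger family gives a representation of `R_A` -/

theorem unitalCstarGen_comm {B : Type v} [CStarAlgebra B] {s : Set B}
    (hs : ∀ a ∈ s, ∀ b ∈ s, a * b = b * a) (hs' : ∀ a ∈ s, ∀ b ∈ s, a * star b = star b * a)
    (x y : unitalCstarGen s) : x * y = y * x := by
  have := StarAlgebra.isMulCommutative_adjoin ℂ hs hs'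
  exact (StarSubalgebra.commRingTopologicalClosure (StarAlgebra.adjoin ℂ s)
    fun a b => mul_comm' a b).mul_comm x y

theorem eq_zero_of_forall_algHom {D : Type v} [CStarAlgebra D] (hD : ∀ x y : D, x * y = y * x)
    {x : D} (h : ∀ χ : D →⋆ₐ[ℂ] ℂ, χ x = 0) : x = 0 := by
  let i : CommCStarAlgebra D := { ‹CStarAlgebra D› with mul_comm := hD }
  have hg : Function.Injective (WeakDual.gelfandTransform ℂ D) :=
    (gelfandTransform_isometry D).injective
  apply hg
  ext φ
  rw [map_zero]
  let χ : D →⋆ₐ[ℂ] ℂ := StarAlgHomClass.toStarAlgHom φ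
  exact h χ

/-- The homomorphism is built as a graph: `E` is generated by the pairs (row, projection) in `ℓ^∞ ×
D`. Once the first projection is injective on `E`, `R_A` lifts to `E` and the second projection
gives `φ`. -/
theorem IsCKFamily.exists_hom {A : Matrix G G (Fin 2)} {B : Type v} [CStarAlgebra B] {S : G → B}
    (h : IsCKFamily A S) : ∃ φ : RAlg A →⋆ₙₐ[ℂ] B, ∀ i,
      φ (deltaR A i) = S i * star (S i) ∧ φ (rhoR A i) = star (S i) * S i := by
  let s : Set B := Set.range (fun i => star (S i) * S i) ∪ Set.range fun i => S i * star (S i)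
  let D := unitalCstarGen s
  let P : G → D := fun i => ⟨star (S i) * S i, subset_unitalCstarGen s (Or.inl ⟨i, rfl⟩)⟩
  let Q : G → D := fun i => ⟨S i * star (S i), subset_unitalCstarGen s (Or.inr ⟨i, rfl⟩)⟩
  have hs : ∀ a ∈ s, ∀ b ∈ s, a * b = b * a := by
    rintro _ (⟨i, rfl⟩ | ⟨i, rfl⟩) _ (⟨j, rfl⟩ | ⟨j, rfl⟩)
    · exact h.commute i j
    · exact h.commute_domain_range i j
    · exact (h.commute_domain_range j i).symm
    · exact h.commute_range i j
  have hsa : ∀ b ∈ s, star b = b := by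
    rintro _ (⟨j, rfl⟩ | ⟨j, rfl⟩) <;> simp
  have hD : ∀ x y : D, x * y = y * x :=
    unitalCstarGen_comm hs fun a ha b hb => by rw [hsa b hb, hs a ha b hb]
  let t : Set (lp (fun _ : G => ℂ) ∞ × D) :=
    Set.range (fun i => (rho A i, P i)) ∪ Set.range fun i => (delta i, Q i)
  let E := cstarGen t
  let f₁ : E →⋆ₙₐ[ℂ] lp (fun _ : G => ℂ) ∞ :=
    (NonUnitalStarAlgHom.fst ℂ _ _).comp (NonUnitalStarSubalgebraClass.subtype E)
  let f₂ : E →⋆ₙₐ[ℂ] B := (D.subtype.toNonUnitalStarAlgHom.comp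
    (NonUnitalStarAlgHom.snd ℂ (lp (fun _ : G => ℂ) ∞) D)).comp
      (NonUnitalStarSubalgebraClass.subtype E)
  have hχ : ∀ (χ : D →⋆ₐ[ℂ] ℂ), ∀ z ∈ E, ‖χ z.2‖ ≤ ‖z.1‖ := by
    intro χ
    obtain ⟨L, hL, hp, hq⟩ := (h.isDiagonalPoint D.subtype Subtype.val_injective P Q
      (fun _ => rfl) (fun _ => rfl) (χ : D →ₐ[ℂ] ℂ)).exists_filter
    have hcont : Continuous χ :=
      NonUnitalStarAlgHom.instContinuousLinearMapClassComplex.map_continuous χ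
    -- The limit along `L` is needed only on polynomials; the norm bound it implies is a closed
    -- condition and passes to `E`.
    have hlim : ∀ z ∈ NonUnitalStarAlgebra.adjoin ℂ t,
        Filter.Tendsto (fun j => z.1 j) L (nhds (χ z.2)) := by
      intro z hz
      induction hz using NonUnitalStarAlgebra.adjoin_induction with
      | mem z hz =>
        rcases hz with ⟨i, rfl⟩ | ⟨i, rfl⟩
        · exact tendsto_nhds_of_eventually_eq (hp i)
        · exact tendsto_nhds_of_eventually_eq (hq i)
      | add x y _ _ hx hy => simpa using hx.add hy
      | zero => simp
      | mul x y _ _ hx hy => simpa using hx.mul hy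
      | smul c x _ hx => simpa using hx.const_mul c
      | star x _ hx => simpa [map_star] using hx.star
    have hcl : IsClosed {z : lp (fun _ : G => ℂ) ∞ × D | ‖χ z.2‖ ≤ ‖z.1‖} :=
      isClosed_le (hcont.comp continuous_snd).norm continuous_fst.norm
    refine fun z hz => closure_minimal (fun z hz => ?_) hcl hz
    exact le_of_tendsto (hlim z hz).norm
      (Filter.Eventually.of_forall fun j => lp.norm_apply_le_norm ENNReal.top_ne_zero z.1 j)
  have hinj : Function.Injective f₁ := by
    refine (injective_iff_map_eq_zero f₁).mpr fun z hz => ?_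
    have hz1 : (z : lp (fun _ : G => ℂ) ∞ × D).1 = 0 := hz
    -- If the first entry is 0, the bound makes every character vanish on the second, which is then
    -- 0 by Gelfand duality.
    refine Subtype.ext (Prod.ext hz1 (eq_zero_of_forall_algHom hD fun χ => ?_))
    have := hχ χ z z.2
    rwa [hz1, norm_zero, norm_le_zero_iff] at this
  let ι : RAlg A →⋆ₙₐ[ℂ] lp (fun _ : G => ℂ) ∞ := NonUnitalStarSubalgebraClass.subtype (RAlg A)
  let eρ : G → E := fun i => ⟨(rho A i, P i), subset_cstarGen t (Or.inl ⟨i, rfl⟩)⟩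
  let eδ : G → E := fun i => ⟨(delta i, Q i), subset_cstarGen t (Or.inr ⟨i, rfl⟩)⟩
  obtain ⟨g, hg⟩ := exists_lift_of_injective
    (cstarGen_coe_preimage (Set.range (rho A) ∪ Set.range delta)) ι f₁ hinj (by
      rintro ⟨x, hx'⟩ (⟨i, rfl⟩ | ⟨i, rfl⟩)
      · exact ⟨eρ i, rfl⟩
      · exact ⟨eδ i, rfl⟩)
  refine ⟨f₂.comp g, fun i => ⟨?_, ?_⟩⟩
  · have : g (deltaR A i) = eδ i := hinj (hg _)
    exact congrArg f₂ this
  · have : g (rhoR A i) = eρ i := hinj (hg _)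
    exact congrArg f₂ this

/-! ### A representation of `R_A` gives a Cuntz–Krieger family -/

/-- The elements on which `e` acts as a two-sided unit form a closed subalgebra, stable under star
because `e` is self-adjoint. -/
theorem isUnit_of_cstarGen_eq_top {C : Type v} [NonUnitalCStarAlgebra C] {s : Set C}
    (hs : cstarGen s = ⊤) {e : C} (he : star e = e) (h : ∀ x ∈ s, e * x = x ∧ x * e = x) (x : C) :
    e * x = x ∧ x * e = x := by
  let D : NonUnitalStarSubalgebra ℂ C :=
    { carrier := {x | e * x = x ∧ x * e = x}
      add_mem' := fun {a b} ha hb => ⟨by rw [mul_add, ha.1, hb.1], by rw [add_mul, ha.2, hb.2]⟩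
      zero_mem' := ⟨mul_zero e, zero_mul e⟩
      mul_mem' := fun {a b} ha hb =>
        ⟨by rw [← mul_assoc, ha.1], by rw [mul_assoc, hb.2]⟩
      smul_mem' := fun c a ha =>
        ⟨by rw [mul_smul_comm, ha.1], by rw [smul_mul_assoc, ha.2]⟩
      star_mem' := fun {a} ha =>
        ⟨by simpa [he] using congrArg star ha.2, by simpa [he] using congrArg star ha.1⟩ }
  have hD : IsClosed (D : Set C) :=
    (isClosed_eq (continuous_const_mul e) continuous_id).inter
      (isClosed_eq (continuous_mul_const e) continuous_id)
  have : cstarGen s ≤ D := cstarGen_le hD h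
  exact this (hs ▸ trivial)

/-- With `p = x^*x`, the C⋆-identity reduces the claim to `p^3 - 2p^2 + p = 0`. -/
theorem partialIsometry_of_isIdempotentElem {C : Type v} [NonUnitalCStarAlgebra C] {x : C}
    (h : star x * x * (star x * x) = star x * x) : x * star x * x = x := by
  rw [← sub_eq_zero, ← CStarRing.star_mul_self_eq_zero_iff]
  have h3 : star x * x * (star x * x) * (star x * x) = star x * x := by rw [h, h]
  simp only [star_sub, star_mul, star_star, mul_sub, sub_mul]
  simp only [← mul_assoc] at h h3 ⊢
  rw [h3, h, sub_self]

/-- The features of `R_A` with its coordinate evaluations that matter for the relations (i)–(iv). -/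
structure IsRowAlgebra (A : Matrix G G (Fin 2)) {R : Type w} [NonUnitalCStarAlgebra R]
    (ev : G → R →⋆ₙₐ[ℂ] ℂ) (ρ δ : G → R) : Prop where
  eq_zero : ∀ r, (∀ j, ev j r = 0) → r = 0
  ev_row : ∀ i j, ev j (ρ i) = ((A i j : ℕ) : ℂ)
  ev_self : ∀ j, ev j (δ j) = 1
  ev_ne : ∀ i j, i ≠ j → ev j (δ i) = 0

theorem starLift_inr {R : Type w} {E : Type v} [NonUnitalCStarAlgebra R] [CStarAlgebra E]
    (Φ : R →⋆ₙₐ[ℂ] E) (r : R) : Unitization.starLift Φ (r : Unitization ℂ R) = Φ r :=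
  DFunLike.congr_fun (Unitization.starLift.symm_apply_apply Φ) r

theorem starLift_inl_add_inr {R : Type w} {E : Type v} [NonUnitalCStarAlgebra R] [CStarAlgebra E]
    (Φ : R →⋆ₙₐ[ℂ] E) (c : ℂ) (r : R) :
    Unitization.starLift Φ (Unitization.inl c + (r : Unitization ℂ R)) = c • (1 : E) + Φ r := by
  rw [map_add, starLift_inr, ← Algebra.algebraMap_eq_smul_one]
  exact congrArg (· + Φ r) (AlgHomClass.commutes (Unitization.starLift Φ) c)

section Family

variable {A : Matrix G G (Fin 2)} {R : Type w} [NonUnitalCStarAlgebra R] {ev : G → R →⋆ₙₐ[ℂ] ℂ}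
  {ρ δ : G → R} {E : Type v} [CStarAlgebra E]

theorem IsRowAlgebra.ext (h : IsRowAlgebra A ev ρ δ) {r s : R} (hrs : ∀ j, ev j r = ev j s) :
    r = s :=
  sub_eq_zero.mp <| h.eq_zero _ fun j => by rw [map_sub, hrs, sub_self]

/-- The only obstruction to coordinatewise checking in the unitization is `1 - e`, where `e ∈ R` is
constantly 1; `hΦ` says that `Φ` kills it. -/
theorem IsRowAlgebra.starLift_eq_zero (h : IsRowAlgebra A ev ρ δ) (Φ : R →⋆ₙₐ[ℂ] E)
    (hΦ : ∀ e : R, (∀ j, ev j e = 1) → Φ e = 1) {x : Unitization ℂ R}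
    (hx : ∀ j, Unitization.starLift (ev j) x = 0) : Unitization.starLift Φ x = 0 := by
  induction x using Unitization.ind with
  | inl_add_inr c r =>
    have hx' : ∀ j, c + ev j r = 0 := fun j => by
      simpa only [starLift_inl_add_inr, smul_eq_mul, mul_one] using hx j
    by_cases hc : c = 0
    · have hr : r = 0 := h.eq_zero r fun j => by simpa [hc] using hx' j
      rw [starLift_inl_add_inr, hc, hr, zero_smul, map_zero, add_zero]
    -- Here `r` is constantly `-c`, so `-c⁻¹ • r` is the constant function 1.
    · have h1 : Φ (-c⁻¹ • r) = 1 := by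
        refine hΦ _ fun j => ?_
        rw [map_smul, smul_eq_mul, eq_neg_of_add_eq_zero_right (hx' j)]
        field_simp
      have h2 : Φ r = -c • (1 : E) := by
        rw [← h1, map_smul, smul_smul, neg_mul_neg, mul_inv_cancel₀ hc, one_smul]
      rw [starLift_inl_add_inr, h2, neg_smul, add_neg_cancel]

theorem IsRowAlgebra.isCKFamily (h : IsRowAlgebra A ev ρ δ) {V : G → E} (Φ : R →⋆ₙₐ[ℂ] E)
    (hΦ : ∀ e : R, (∀ j, ev j e = 1) → Φ e = 1)
    (hV : ∀ i, Φ (δ i) = V i * star (V i) ∧ Φ (ρ i) = star (V i) * V i) :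
    IsCKFamily A V := by
  classical
  let Ψ : Unitization ℂ R →⋆ₐ[ℂ] E := Unitization.starLift Φ
  let ε : G → Unitization ℂ R →⋆ₐ[ℂ] ℂ := fun j => Unitization.starLift (ev j)
  let P : G → Unitization ℂ R := fun i => (ρ i : Unitization ℂ R)
  let Q : G → Unitization ℂ R := fun i => (δ i : Unitization ℂ R)
  have hP : ∀ i, Ψ (P i) = star (V i) * V i := fun i => (starLift_inr Φ _).trans (hV i).2
  have hQ : ∀ i, Ψ (Q i) = V i * star (V i) := fun i => (starLift_inr Φ _).trans (hV i).1
  have eP : ∀ i j, ε j (P i) = ((A i j : ℕ) : ℂ) := fun i j =>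
    (starLift_inr (ev j) _).trans (h.ev_row i j)
  have eQ : ∀ i j, ε j (Q i) = if i = j then 1 else 0 := fun i j => by
    split_ifs with hij
    · exact hij ▸ (starLift_inr (ev i) _).trans (h.ev_self i)
    · exact (starLift_inr (ev j) _).trans (h.ev_ne i j hij)
  -- Reduces each relation below to an identity of complex numbers at every coordinate.
  have key : ∀ {x y : Unitization ℂ R}, (∀ j, ε j x = ε j y) → Ψ x = Ψ y := fun {x y} hxy => by
    rw [← sub_eq_zero, ← map_sub]
    exact h.starLift_eq_zero Φ hΦ fun j => by
      rw [map_sub, sub_eq_zero]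
      exact hxy j
  have hc : ∀ (c : ℂ) x, Ψ (c • x) = c • Ψ x := map_smul Ψ
  have hcomm : ∀ i j, Commute (P i) (P j) := fun i j => by
    change (ρ i : Unitization ℂ R) * (ρ j : Unitization ℂ R) = ρ j * ρ i
    rw [← Unitization.inr_mul, ← Unitization.inr_mul]
    congr 1
    exact h.ext fun k => by rw [map_mul, map_mul, mul_comm]
  refine ⟨fun i => partialIsometry_of_isIdempotentElem ?_, fun i j => ?_, fun i j => ?_,
    fun i j => ?_, fun X Y hXY => ?_⟩
  · rw [← hP, ← map_mul]
    refine key fun k => ?_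
    rw [map_mul, eP]
    rcases entry_eq_zero_or_one A i k with h | h <;> simp [h]
  · simpa only [hP] using (hcomm i j).map Ψ
  · have : Ψ (Q i * Q j) = Ψ (if i = j then Q i else 0) := by
      refine key fun k => ?_
      rw [map_mul, apply_ite (ε k), map_zero, eQ, eQ]
      split_ifs <;> simp_all
    rwa [map_mul, apply_ite Ψ, map_zero, hQ, hQ] at this
  · have : Ψ (P i * Q j) = Ψ (((A i j : ℕ) : ℂ) • Q j) := by
      refine key fun k => ?_
      rw [map_mul, map_smul, eP, eQ, smul_eq_mul]
      split_ifs with h <;> simp [h]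
    rwa [map_mul, hc, hP, hQ] at this
  · have hX : (X : Set G).Pairwise (Function.onFun Commute P) := fun x _ y _ _ => hcomm x y
    have hY : (Y : Set G).Pairwise (Function.onFun Commute fun y => 1 - P y) :=
      fun x _ y _ _ => (Commute.one_left _).sub_left ((Commute.one_right _).sub_right (hcomm x y))
    have hR : Ψ (X.noncommProd P hX * Y.noncommProd (fun y => 1 - P y) hY) =
        Ψ (∑ j ∈ hXY.toFinset, coeff A X Y j • Q j) := by
      refine key fun k => ?_
      rw [map_mul, Finset.map_noncommProd, Finset.map_noncommProd, map_sum,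
        Finset.noncommProd_eq_prod, Finset.noncommProd_eq_prod]
      simp only [map_sub, map_one, map_smul, eP, eQ, smul_eq_mul, mul_ite, mul_one, mul_zero]
      -- At coordinate `k` only the term `j = k` survives; off the support of `coeff A X Y` both
      -- sides are 0.
      rw [Finset.sum_ite_eq' hXY.toFinset k]
      split_ifs with hk
      · rfl
      · rw [Set.Finite.mem_toFinset, Function.mem_support, not_not] at hk
        exact hk
    rw [map_mul, Finset.map_noncommProd, Finset.map_noncommProd, map_sum] at hR
    simp only [map_sub, map_one, hc, hP, hQ] at hR
    exact hR

theorem IsRowAlgebra.exists_isCKFamily_embedding (h : IsRowAlgebra A ev ρ δ) {D : Type v}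
    [NonUnitalCStarAlgebra D] {T : G → D} (hT : cstarGen (Set.range T) = ⊤) (φ : R →⋆ₙₐ[ℂ] D)
    (hφ : ∀ i, φ (δ i) = T i * star (T i) ∧ φ (ρ i) = star (T i) * T i) :
    ∃ (E : Type v) (_ : CStarAlgebra E) (ι : D →⋆ₙₐ[ℂ] E), Function.Injective ι ∧
      IsCKFamily A fun i => ι (T i) := by
  have hc : ∀ {E : Type v} [CStarAlgebra E] (ι : D →⋆ₙₐ[ℂ] E) (i : G),
      (ι.comp φ) (δ i) = ι (T i) * star (ι (T i)) ∧
        (ι.comp φ) (ρ i) = star (ι (T i)) * ι (T i) := fun ι i => by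
    rw [← map_star, ← map_mul, ← map_mul, ← (hφ i).1, ← (hφ i).2]
    exact ⟨rfl, rfl⟩
  by_cases he : ∃ e : R, ∀ j, ev j e = 1
  · obtain ⟨e, he⟩ := he
    have h1 : ∀ r : R, e * r = r := fun r => h.ext fun j => by rw [map_mul, he, one_mul]
    have h2 : ∀ r : R, r * e = r := fun r => h.ext fun j => by rw [map_mul, he, mul_one]
    have h3 : star e = e := h.ext fun j => by rw [map_star, he, star_one]
    -- The image of the constant 1 fixes the initial and final projections of each `T i`, a partial
    -- isometry because `ρ i` is idempotent. Hence it is a unit for `D`.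
    have hu := isUnit_of_cstarGen_eq_top hT (e := φ e) (by rw [← map_star, h3]) (by
      rintro _ ⟨i, rfl⟩
      have hp : T i * star (T i) * T i = T i := partialIsometry_of_isIdempotentElem <| by
        rw [← (hφ i).2, ← map_mul]
        congr 1
        refine h.ext fun k => ?_
        rw [map_mul, h.ev_row]
        rcases entry_eq_zero_or_one A i k with h | h <;> simp [h]
      have hl : φ e * (T i * star (T i)) = T i * star (T i) := by rw [← (hφ i).1, ← map_mul, h1]
      have hr : star (T i) * T i * φ e = star (T i) * T i := by rw [← (hφ i).2, ← map_mul, h2]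
      constructor
      · calc φ e * T i = φ e * (T i * star (T i)) * T i := by rw [mul_assoc, hp]
          _ = T i := by rw [hl, hp]
      · calc T i * φ e = T i * (star (T i) * T i * φ e) := by
              rw [← mul_assoc, ← mul_assoc, hp]
          _ = T i := by rw [hr, ← mul_assoc, hp])
    obtain ⟨E, _, ι, hι, h1'⟩ := exists_cstarAlgebra_of_unit (φ e) (fun x => (hu x).1)
      fun x => (hu x).2
    refine ⟨E, _, ι, hι, h.isCKFamily (ι.comp φ) (fun e' he' => ?_) (hc ι)⟩
    rw [← h1', show e' = e from h.ext fun j => (he' j).trans (he j).symm]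
    rfl
  -- Without a constant 1 in `R` the unit condition is vacuous, so any unital algebra containing `D`
  -- serves.
  · obtain ⟨E, _, ι, hι⟩ := exists_unital_embedding (C := D)
    exact ⟨E, _, ι, hι, h.isCKFamily (ι.comp φ) (fun e' he' => absurd ⟨e', he'⟩ he) (hc ι)⟩

end Family

/-- Evaluation at a point, on `ℓ^∞`. -/
def evalLp (j : G) : lp (fun _ : G => ℂ) ∞ →⋆ₙₐ[ℂ] ℂ where
  toFun x := x j
  map_smul' _ _ := rfl
  map_zero' := rfl
  map_add' _ _ := rfl
  map_mul' _ _ := rfl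
  map_star' _ := rfl

/-- The restriction of a complex homomorphism to a generated subalgebra. -/
def restrictCstarGen {B : Type v} [NonUnitalCStarAlgebra B] (s : Set B) (f : B →⋆ₙₐ[ℂ] ℂ) :
    cstarGen s →⋆ₙₐ[ℂ] ℂ :=
  f.comp (NonUnitalStarSubalgebraClass.subtype (cstarGen s))

theorem isRowAlgebra_rAlg (A : Matrix G G (Fin 2)) :
    IsRowAlgebra (R := cstarGen (Set.range (rho A) ∪ Set.range delta)) A
      (fun j => restrictCstarGen _ (evalLp j)) (rhoR A) (deltaR A) where
  eq_zero _ hr := Subtype.ext <| lp.ext <| funext hr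
  ev_row _ _ := rfl
  ev_self j := (delta_apply j j).trans (if_pos rfl)
  ev_ne i j hij := (delta_apply i j).trans (if_neg hij)

/-! ### The universal property of `O_A` -/

/-- The inclusion of `O_A` into `\tilde O_A`. -/
def oAlgInclusion (A : Matrix G G (Fin 2)) : OAlg A →⋆ₙₐ[ℂ] OTilde A :=
  NonUnitalStarSubalgebraClass.subtype (cstarGen (Set.range (genTilde A)))

theorem oAlgInclusion_injective (A : Matrix G G (Fin 2)) : Function.Injective (oAlgInclusion A) :=
  Subtype.val_injective

theorem cstarGen_corestrict_eq_top {B : Type v} [NonUnitalCStarAlgebra B] (T : G → B) :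
    cstarGen (Set.range fun i => (⟨T i, subset_cstarGen _ ⟨i, rfl⟩⟩ : cstarGen (Set.range T))) =
      ⊤ := by
  rw [← cstarGen_coe_preimage (Set.range T)]
  congr 1
  ext ⟨x, hx⟩
  simp [Subtype.ext_iff]

theorem cstarGen_range_genO (A : Matrix G G (Fin 2)) : cstarGen (Set.range (genO A)) = ⊤ :=
  cstarGen_corestrict_eq_top (genTilde A)

/-- The codomain can be shrunk to `C^*({T_i})` because the images of the generators of `R_A` lie
there. -/
theorem ExtendsToRAlg.of_hom {A : Matrix G G (Fin 2)} {B : Type v} [NonUnitalCStarAlgebra B]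
    {T : G → B} (φ : RAlg A →⋆ₙₐ[ℂ] B)
    (hφ : ∀ i, φ (deltaR A i) = T i * star (T i) ∧ φ (rhoR A i) = star (T i) * T i) :
    ExtendsToRAlg A T := by
  have hT : ∀ i, T i ∈ cstarGen (Set.range T) := fun i => subset_cstarGen _ ⟨i, rfl⟩
  obtain ⟨g, hg⟩ := exists_lift_of_injective
    (cstarGen_coe_preimage (Set.range (rho A) ∪ Set.range delta)) φ
    (NonUnitalStarSubalgebraClass.subtype (cstarGen (Set.range T))) Subtype.val_injective (by
      rintro ⟨x, hx'⟩ (⟨i, rfl⟩ | ⟨i, rfl⟩)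
      · exact ⟨⟨_, mul_mem (star_mem (hT i)) (hT i)⟩, (hφ i).2.symm⟩
      · exact ⟨⟨_, mul_mem (hT i) (star_mem (hT i))⟩, (hφ i).1.symm⟩)
  exact ⟨g, fun i => ⟨(hg _).trans (hφ i).1, (hg _).trans (hφ i).2⟩⟩

theorem extendsToRAlg_genO (A : Matrix G G (Fin 2)) : ExtendsToRAlg A (genO A) := by
  obtain ⟨φ, hφ⟩ := (isCKFamily_genTilde A).exists_hom
  obtain ⟨g, hg⟩ := exists_lift_of_injective
    (cstarGen_coe_preimage (Set.range (rho A) ∪ Set.range delta)) φ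
    (oAlgInclusion A) (oAlgInclusion_injective A) (by
      rintro ⟨x, hx'⟩ (⟨i, rfl⟩ | ⟨i, rfl⟩)
      · exact ⟨star (genO A i) * genO A i, (hφ i).2.symm⟩
      · exact ⟨genO A i * star (genO A i), (hφ i).1.symm⟩)
  exact ExtendsToRAlg.of_hom g fun i =>
    ⟨oAlgInclusion_injective A ((hg _).trans (hφ i).1),
      oAlgInclusion_injective A ((hg _).trans (hφ i).2)⟩

theorem exists_hom_of_extendsToRAlg {A : Matrix G G (Fin 2)} {B : Type w} [NonUnitalCStarAlgebra B]
    {T : G → B} (hT : ExtendsToRAlg A T) : ∃ ψ : OAlg A →⋆ₙₐ[ℂ] B, ∀ i, ψ (genO A i) = T i := by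
  obtain ⟨φ, hφ⟩ := hT
  let D := cstarGen (Set.range T)
  let T' : G → D := fun i => ⟨T i, subset_cstarGen _ ⟨i, rfl⟩⟩
  obtain ⟨E, _, ι, hι, hE⟩ := (isRowAlgebra_rAlg A).exists_isCKFamily_embedding (T := T')
    (cstarGen_corestrict_eq_top T) φ
    fun i => ⟨Subtype.ext (hφ i).1, Subtype.ext (hφ i).2⟩
  obtain ⟨θ, hθ, -⟩ := oTilde_universal A _ hE
  -- On `OAlg A` the unital map `θ` sends generators into the image of `ι`, so it descends to the
  -- non-unital algebra `D`.
  obtain ⟨g, hg⟩ := exists_lift_of_injective (cstarGen_range_genO A)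
    (θ.toNonUnitalStarAlgHom.comp (oAlgInclusion A)) ι hι (by
      rintro _ ⟨i, rfl⟩
      exact ⟨T' i, (hθ i).symm⟩)
  refine ⟨(NonUnitalStarSubalgebraClass.subtype D).comp g, fun i => ?_⟩
  have : g (genO A i) = T' i := hι ((hg _).trans (hθ i))
  exact congrArg Subtype.val this

theorem isUniversalForRAlg_oAlg (A : Matrix G G (Fin 2)) :
    IsUniversalForRAlg.{u, u, w} A (OAlg A) (genO A) where
  generates := cstarGen_range_genO A
  condition := extendsToRAlg_genO A
  lift B _ T hT := by
    obtain ⟨ψ, hψ⟩ := exists_hom_of_extendsToRAlg hT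
    refine ⟨ψ, hψ, fun ψ' hψ' => hom_ext_of_cstarGen_eq_top (cstarGen_range_genO A) ?_⟩
    rintro _ ⟨i, rfl⟩
    rw [hψ, hψ']

theorem IsUniversalForRAlg.existsUnique_equiv {A : Matrix G G (Fin 2)} {U V : Type v}
    [NonUnitalCStarAlgebra U] [NonUnitalCStarAlgebra V] {s : G → U} {t : G → V}
    (hU : IsUniversalForRAlg.{u, v, v} A U s) (hV : IsUniversalForRAlg.{u, v, v} A V t) :
    ∃! e : U ≃⋆ₐ[ℂ] V, ∀ i, e (s i) = t i := by
  obtain ⟨f, hf, -⟩ := hU.lift V t hV.condition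
  obtain ⟨g, hg, -⟩ := hV.lift U s hU.condition
  have hgf : g.comp f = NonUnitalStarAlgHom.id ℂ U :=
    hom_ext_of_cstarGen_eq_top hU.generates <| by
      rintro _ ⟨i, rfl⟩
      simp [hf, hg]
  have hfg : f.comp g = NonUnitalStarAlgHom.id ℂ V :=
    hom_ext_of_cstarGen_eq_top hV.generates <| by
      rintro _ ⟨i, rfl⟩
      simp [hf, hg]
  refine ⟨StarAlgEquiv.ofBijective f
    (Function.bijective_iff_has_inverse.mpr ⟨g, DFunLike.congr_fun hgf, DFunLike.congr_fun hfg⟩),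
    hf, fun e he => ?_⟩
  have : (e : U →⋆ₙₐ[ℂ] V) = f := hom_ext_of_cstarGen_eq_top hU.generates <| by
    rintro _ ⟨i, rfl⟩
    exact (he i).trans (hf i).symm
  exact DFunLike.ext _ _ fun x => DFunLike.congr_fun this x

end CuntzKrieger

end

theorem mainTheorem2 {G : Type u} (A : Matrix G G (Fin 2))
    (hA : ∀ i, ∃ j, A i j = 1) :
    CuntzKrieger.IsUniversalForRAlg.{u, u, w} A
        (CuntzKrieger.OAlg A) (CuntzKrieger.genO A) ∧
      ∀ (U : Type u) [NonUnitalCStarAlgebra U] (s : G → U),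
        CuntzKrieger.IsUniversalForRAlg.{u, u, u} A U s →
          ∃! e : CuntzKrieger.OAlg A ≃⋆ₐ[ℂ] U, ∀ i, e (CuntzKrieger.genO A i) = s i :=
  ⟨CuntzKrieger.isUniversalForRAlg_oAlg A, fun _ _ _ hU =>
    (CuntzKrieger.isUniversalForRAlg_oAlg A).existsUnique_equiv hU⟩
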